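/- Let $n\ge 2$ be even and $m=n/2$. Let $\nu>0$ and $\kappa_1,\dots,\kappa_{n-1}$ be real constants with $\kappa_j>0$ for $1\le j\le n-2$ and $\kappa_{n-1}\neq 0$. Let $I\subseteq\mathbb R$ be a non-degenerate interval and let $f:I\to\mathbb R^n$ be a curve of class $C^n$ that is $(n-1)$-regular, that is, $f'(t),\dots,f^{(n-1)}(t)$ are linearly independent for every $t\in I$. Its Frenet frame $V_1,\dots,V_n$ is obtained by orthonormalizing $f',\dots,f^{(n-1)}$ (Gram--Schmidt) to get $V_1,\dots,V_{n-1}$ and putting $V_n=V_1\times\cdots\times V_{n-1}$ (so that the frame is orthonormal and positively oriented), and its curvatures are $\frac{V_j'\cdot V_{j+1}}{\|f'\|}$, $1\le j\le n-1$. Suppose that $f$ has constant speed $\|f'\|=\nu$ and that its $j$-th curvature is the constant $\kappa_j$, for $1\le j\le n-1$. Then there exist positive real numbers $a_1,\dots,a_m$ and $r_1,\dots,r_m$ and an isometry $F$ of $\mathbb R^n$ (not necessarily orientation preserving) such that, under the identification of $(x_1,y_1,\dots,x_m,y_m)\in\mathbb R^n$ with $(x_1+\mathbf i y_1,\dots,x_m+\mathbf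 i y_m)\in\mathbb C^m$, $$F(f(t))=\bigl(r_1e^{\mathbf i a_1t},\,r_2e^{\mathbf i a_2t},\dots,r_me^{\mathbf i a_mt}\bigr)\qquad\text{for all }t\in I .$$ -/

import Mathlib

open scoped InnerProductSpace

namespace EuclideanCurve

noncomputable section

/-- The generalized cross product of `n - 1` vectors of `ℝⁿ`: the vector `w` whose `i`-th coordinate is
`det (v₁, …, vₙ₋₁, eᵢ)`, so that `w · X = det (v₁, …, vₙ₋₁, X)` for all `X`. -/
def crossProd {n : ℕ} (v : Fin (n - 1) → EuclideanSpace ℝ (Fin n)) : EuclideanSpace ℝ (Fin n) :=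
  WithLp.toLp 2 fun i =>
    Matrix.det (Matrix.of fun k l : Fin n =>
      if h : (k : ℕ) < n - 1 then v ⟨k, h⟩ l else (Pi.single i (1 : ℝ) : Fin n → ℝ) l)

/-- `f` is a `k`-regular curve on `I`: at each `t ∈ I` the derivatives `f', f'', …, f⁽ᵏ⁾` are linearly
independent. -/
def IsRegular {n : ℕ} (k : ℕ) (f : ℝ → EuclideanSpace ℝ (Fin n)) (I : Set ℝ) : Prop :=
  ∀ t ∈ I, LinearIndependent ℝ fun i : Fin k => iteratedDerivWithin ((i : ℕ) + 1) f I t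

/-- The speed `ν = ‖f'‖`. -/
def speed {n : ℕ} (f : ℝ → EuclideanSpace ℝ (Fin n)) (I : Set ℝ) (t : ℝ) : ℝ :=
  ‖derivWithin f I t‖

/-- The vector `Vⱼ(t)`, `1 ≤ j ≤ n`, of the Frenet frame of an `(n-1)`-regular curve: `V₁, …, Vₙ₋₁` come
from `f', …, f⁽ⁿ⁻¹⁾` by Gram-Schmidt orthonormalization, and `Vₙ = V₁ × ⋯ × Vₙ₋₁`. -/
def frenetVector {n : ℕ} (f : ℝ → EuclideanSpace ℝ (Fin n)) (I : Set ℝ) (j : ℕ) (t : ℝ) :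
    EuclideanSpace ℝ (Fin n) :=
  if j < n then
    InnerProductSpace.gramSchmidtNormed ℝ (fun k : ℕ => iteratedDerivWithin (k + 1) f I t) (j - 1)
  else
    crossProd fun i : Fin (n - 1) =>
      InnerProductSpace.gramSchmidtNormed ℝ (fun k : ℕ => iteratedDerivWithin (k + 1) f I t) i

/-- The curvature `κⱼ(t)`, `1 ≤ j ≤ n - 1`: the coefficient in the Frenet equation
`Vⱼ' = - κⱼ₋₁ ν Vⱼ₋₁ + κⱼ ν Vⱼ₊₁`, that is, `κⱼ = (Vⱼ' · Vⱼ₊₁) / ν`. -/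
def curvature {n : ℕ} (f : ℝ → EuclideanSpace ℝ (Fin n)) (I : Set ℝ) (j : ℕ) (t : ℝ) : ℝ :=
  ⟪derivWithin (frenetVector f I j) I t, frenetVector f I (j + 1) t⟫_ℝ / speed f I t

/-- The complex representation `(x₁ + i y₁, …, xₘ + i yₘ) ∈ ℂᵐ`, `m = n / 2`, of
`(x₁, y₁, …, xₘ, yₘ) ∈ ℝⁿ`, for `n` even. -/
def complexRep {n : ℕ} (X : EuclideanSpace ℝ (Fin n)) : EuclideanSpace ℂ (Fin (n / 2)) :=
  WithLp.toLp 2 fun j =>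
    ⟨X ⟨2 * (j : ℕ), by have := j.isLt; omega⟩, X ⟨2 * (j : ℕ) + 1, by have := j.isLt; omega⟩⟩

end

end EuclideanCurve

/-!
Write `X 0, …, X (n - 1)` for the Frenet frame and `m = n / 2`. Each `X i` is differentiable and
orthogonal to `f', …, f⁽ⁱ⁾`, so the matrix `⟪X i', X j⟫` is skew and vanishes for `j > i + 1`
(`IsRegular.inner_derivWithin_frenetVector_eq_zero`). It is therefore tridiagonal with zero diagonal,
and its superdiagonal `ω i = ν κ (i + 1)` is constant and nowhere zero.

A tridiagonal matrix with zero diagonal exchanges even and odd indices. With `α k = X (2 k)`,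
`β k = X (2 k + 1)` the Frenet equations become `α' = B β`, `β' = -Bᵀ α` for a constant `m × m`
bidiagonal matrix `B` with nonzero diagonal and subdiagonal (`skewBidiagonal`). In the singular bases
`u j`, `v j` of `B` (`Matrix.exists_singular_bases`) they decouple: `P j = ∑ k, u j k • α k` and
`Q j = ∑ l, v j l • β l` satisfy `P j' = a j • Q j`, `Q j' = -a j • P j` with the singular values
`a j > 0`, so that `Q j` rotates uniformly in a fixed plane (`eq_cos_smul_sub_sin_smul`), and these
planes are mutually orthogonal.

Since `f' = ν α 0 = ν ∑ j, u j 0 • P j`, the curve `f + ∑ j, (ν u j 0 / a j) • Q j` is constant, which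
exhibits `f` as a sum of circular motions of radii `ν |u j 0| / a j` (`exists_circular_motions`). The
radii do not vanish because a singular vector of `B` with first coordinate zero is zero
(`eq_zero_of_skewBidiagonal_singular`). An isometry moves the planes to the coordinate planes of `ℂᵐ`;
the orientations and the phases are absorbed in the choice of the orthonormal bases of the planes.
-/

/-! ### Gram-Schmidt and the cross product -/

open InnerProductSpace in
theorem differentiableOn_gramSchmidt {E : Type*} [NormedAddCommGroup E] [InnerProductSpace ℝ E]
    {g : ℕ → ℝ → E} {I : Set ℝ} {N : ℕ} (hg : ∀ k < N, DifferentiableOn ℝ (g k) I)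
    (h0 : ∀ k < N, ∀ t ∈ I, gramSchmidt ℝ (fun k => g k t) k ≠ 0) :
    ∀ k < N, DifferentiableOn ℝ (fun t => gramSchmidt ℝ (fun k => g k t) k) I := by
  intro k
  induction k using Nat.strong_induction_on with
  | _ k ih =>
    intro hk
    simp_rw [gramSchmidt_def ℝ _ k, Submodule.starProjection_singleton]
    refine (hg k hk).sub (DifferentiableOn.fun_sum fun i hi => ?_)
    have hik : i < k := Finset.mem_Iio.1 hi
    have h1 := ih i hik (hik.trans hk)
    refine DifferentiableOn.fun_smul ?_ h1
    refine (h1.inner ℝ (hg k hk)).div ?_ fun t ht => ?_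
    · exact h1.norm_sq ℝ
    · simpa using h0 i (hik.trans hk) t ht

namespace EuclideanCurve

/-- The cross product of orthonormal vectors is, up to sign, the unit vector that completes them to an
orthonormal basis `b`: its coordinates are the cofactors of the last row in the orthogonal matrix with
rows `b k`, so it has inner product `det = ± 1` with the last row and `0` with the others. -/
theorem exists_crossProd_eq_smul {n : ℕ} (hn : 0 < n) {v : Fin (n - 1) → EuclideanSpace ℝ (Fin n)}
    (hv : Orthonormal ℝ v) :
    ∃ (b : OrthonormalBasis (Fin n) ℝ (EuclideanSpace ℝ (Fin n))) (d : ℝ),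
      (∀ k : Fin (n - 1), b ⟨k, by omega⟩ = v k) ∧ d * d = 1 ∧
        crossProd v = d • b ⟨n - 1, by omega⟩ := by
  classical
  set last : Fin n := ⟨n - 1, by omega⟩ with hlast
  let w : Fin n → EuclideanSpace ℝ (Fin n) := fun k => if h : (k : ℕ) < n - 1 then v ⟨k, h⟩ else 0
  have hw : Orthonormal ℝ (Set.domRestrict {k : Fin n | (k : ℕ) < n - 1} w) := by
    have : Set.domRestrict {k : Fin n | (k : ℕ) < n - 1} w =
        v ∘ fun k : {k : Fin n | (k : ℕ) < n - 1} => ⟨k, k.2⟩ := by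
      funext k
      have hk : ((k : Fin n) : ℕ) < n - 1 := k.2
      simp only [Set.domRestrict_apply, w, Function.comp_apply, hk, dif_pos]
    rw [this]
    refine hv.comp _ fun i j hij => ?_
    simp only [Fin.mk.injEq] at hij
    exact Subtype.ext (Fin.ext hij)
  obtain ⟨b, hb⟩ := hw.exists_orthonormalBasis_extension_of_card_eq (by simp)
  have hbv : ∀ k : Fin (n - 1), b ⟨k, by omega⟩ = v k := fun k => by
    rw [hb _ (by simp)]
    simp [w]
  let A : Matrix (Fin n) (Fin n) ℝ := Matrix.of fun k l => b k l
  have hcross : ∀ i, crossProd v i = A.adjugate i last := by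
    intro i
    rw [Matrix.adjugate_apply]
    simp only [crossProd]
    congr 1
    ext k l
    by_cases hk : (k : ℕ) < n - 1
    · have : k ≠ last := fun h => by simp [h, hlast] at hk
      rw [Matrix.updateRow_ne this]
      simp only [Matrix.of_apply, hk, dif_pos, A]
      rw [← hbv ⟨k, hk⟩]
    · have : k = last := Fin.ext (by simp [hlast]; omega)
      subst this
      rw [Matrix.updateRow_self]
      simp only [Matrix.of_apply, dif_neg hk]
  have hinner : ∀ k, ⟪b k, crossProd v⟫_ℝ = if k = last then A.det else 0 := by
    intro k
    have h := congrFun (congrFun (Matrix.mul_adjugate A) k) last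
    rw [Matrix.mul_apply, Matrix.smul_apply, Matrix.one_apply] at h
    rw [PiLp.inner_apply]
    simp only [hcross]
    simp only [A, Matrix.of_apply] at h ⊢
    simp only [RCLike.inner_apply, conj_trivial]
    simp_rw [mul_comm (Matrix.adjugate _ _ _)]
    simpa using h
  have hAA : A * A.transpose = 1 := by
    ext i j
    rw [Matrix.mul_apply, Matrix.one_apply, ← orthonormal_iff_ite.1 b.orthonormal i j,
      PiLp.inner_apply]
    simp [A, mul_comm]
  refine ⟨b, A.det, hbv, ?_, ?_⟩
  · simpa using congrArg Matrix.det hAA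
  · refine InnerProductSpace.ext_inner_left_basis b.toBasis fun k => ?_
    rw [b.coe_toBasis, hinner, inner_smul_right, orthonormal_iff_ite.1 b.orthonormal]
    simp

theorem differentiableOn_crossProd {n : ℕ} {v : ℝ → Fin (n - 1) → EuclideanSpace ℝ (Fin n)}
    {I : Set ℝ} (hv : ∀ i, DifferentiableOn ℝ (fun t => v t i) I) :
    DifferentiableOn ℝ (fun t => crossProd (v t)) I := by
  rw [differentiableOn_euclidean]
  intro i
  simp only [crossProd, Matrix.det_apply]
  refine DifferentiableOn.fun_sum fun σ _ => DifferentiableOn.const_smul ?_ _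
  refine DifferentiableOn.fun_finsetProd fun k _ => ?_
  simp only [Matrix.of_apply]
  split_ifs with h
  · exact differentiableOn_euclidean.1 (hv _) _
  · exact differentiableOn_const _

end EuclideanCurve

/-! ### The Frenet frame -/

theorem Set.OrdConnected.uniqueDiffOn_of_nontrivial {I : Set ℝ} (hI : I.OrdConnected)
    (hne : I.Nontrivial) : UniqueDiffOn ℝ I := by
  refine uniqueDiffOn_convex hI.convex ?_
  obtain ⟨x, hx, y, hy, hxy⟩ := hne.exists_lt
  exact ⟨(x + y) / 2, interior_mono (hI.out hx hy) (by rw [interior_Icc]; constructor <;> linarith)⟩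

/-- The product rule for a pair of vector functions with constant inner product. -/
theorem inner_derivWithin_add_eq_zero {E : Type*} [NormedAddCommGroup E] [InnerProductSpace ℝ E]
    {I : Set ℝ} (hI : UniqueDiffOn ℝ I) {x y : ℝ → E} (hx : DifferentiableOn ℝ x I)
    (hy : DifferentiableOn ℝ y I) {c : ℝ} (h : ∀ t ∈ I, ⟪x t, y t⟫_ℝ = c) {t : ℝ} (ht : t ∈ I) :
    ⟪derivWithin x I t, y t⟫_ℝ + ⟪x t, derivWithin y I t⟫_ℝ = 0 := by
  have h1 := (hx t ht).hasDerivWithinAt.inner ℝ (hy t ht).hasDerivWithinAt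
  have h2 : HasDerivWithinAt (fun t => ⟪x t, y t⟫_ℝ) 0 I t :=
    (hasDerivWithinAt_const t I c).congr h (h t ht)
  rw [add_comm]
  exact (hI t ht).eq_deriv _ h1 h2

namespace EuclideanCurve

section

open InnerProductSpace

variable {n : ℕ} {f : ℝ → EuclideanSpace ℝ (Fin n)} {I : Set ℝ}

theorem frenetVector_succ_of_lt {i : ℕ} (hi : i + 1 < n) (t : ℝ) :
    frenetVector f I (i + 1) t =
      gramSchmidtNormed ℝ (fun k : ℕ => iteratedDerivWithin (k + 1) f I t) i := by
  simp [frenetVector, hi]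

theorem frenetVector_last (t : ℝ) :
    frenetVector f I n t = crossProd fun i : Fin (n - 1) => frenetVector f I (i + 1) t := by
  simp only [frenetVector, lt_irrefl, if_false]
  congr 1
  funext i
  rw [if_pos (by omega), Nat.add_sub_cancel]

theorem IsRegular.linearIndependent_Iic (h : IsRegular (n - 1) f I) {t : ℝ} (ht : t ∈ I) {i : ℕ}
    (hi : i + 1 < n) :
    LinearIndependent ℝ
      ((fun k : ℕ => iteratedDerivWithin (k + 1) f I t) ∘ ((↑) : Set.Iic i → ℕ)) := by
  have hlt : ∀ k : Set.Iic i, (k : ℕ) < n - 1 := fun k => by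
    have : (k : ℕ) ≤ i := k.2
    omega
  refine (h t ht).comp (fun k : Set.Iic i => (⟨k, hlt k⟩ : Fin (n - 1))) fun k l hkl => ?_
  simp only [Fin.mk.injEq] at hkl
  exact Subtype.ext hkl

theorem IsRegular.orthonormal_initial (h : IsRegular (n - 1) f I) {t : ℝ} (ht : t ∈ I) :
    Orthonormal ℝ fun i : Fin (n - 1) => frenetVector f I (i + 1) t := by
  have hlt : ∀ i : Fin (n - 1), (i : ℕ) + 1 < n := fun i => by omega
  refine ⟨fun i => ?_, fun i j hij => ?_⟩
  · change ‖frenetVector f I (i + 1) t‖ = 1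
    rw [frenetVector_succ_of_lt (hlt i)]
    exact gramSchmidtNormed_unit_length_coe _ (h.linearIndependent_Iic ht (hlt i))
  · change ⟪frenetVector f I (i + 1) t, frenetVector f I (j + 1) t⟫_ℝ = 0
    rw [frenetVector_succ_of_lt (hlt i), frenetVector_succ_of_lt (hlt j)]
    simp only [gramSchmidtNormed, inner_smul_left, inner_smul_right]
    rw [gramSchmidt_orthogonal ℝ _ fun h => hij (Fin.ext h)]
    simp

theorem IsRegular.orthonormal_frenetVector (hn : 0 < n) (h : IsRegular (n - 1) f I) {t : ℝ}
    (ht : t ∈ I) : Orthonormal ℝ fun i : Fin n => frenetVector f I (i + 1) t := by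
  obtain ⟨b, d, hb, hd, hbd⟩ := exists_crossProd_eq_smul hn (h.orthonormal_initial ht)
  have key : ∀ i : Fin n, ∃ c : ℝ, c * c = 1 ∧ frenetVector f I (i + 1) t = c • b i := by
    intro i
    by_cases hi : (i : ℕ) < n - 1
    · exact ⟨1, one_mul 1, by rw [one_smul]; exact (hb ⟨i, hi⟩).symm⟩
    · have hi' : (i : ℕ) + 1 = n := by omega
      refine ⟨d, hd, ?_⟩
      rw [hi', frenetVector_last, hbd]
      congr 2
      exact Fin.ext (by simp only; omega)
  choose c hc hX using key
  rw [orthonormal_iff_ite]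
  intro i j
  rw [hX, hX, inner_smul_left, inner_smul_right, orthonormal_iff_ite.1 b.orthonormal]
  split_ifs with hij
  · subst hij
    simpa using hc i
  · simp

theorem hasDerivWithinAt_iteratedDerivWithin (hI : UniqueDiffOn ℝ I) (hf : ContDiffOn ℝ n f I)
    {k : ℕ} (hk : k < n) {t : ℝ} (ht : t ∈ I) :
    HasDerivWithinAt (iteratedDerivWithin k f I) (iteratedDerivWithin (k + 1) f I t) I t := by
  rw [iteratedDerivWithin_succ]
  exact (hf.differentiableOn_iteratedDerivWithin (by exact_mod_cast hk) hI t ht).hasDerivWithinAt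

theorem IsRegular.differentiableOn_frenetVector (hI : UniqueDiffOn ℝ I) (hf : ContDiffOn ℝ n f I)
    (h : IsRegular (n - 1) f I) {i : ℕ} (hi : i < n) :
    DifferentiableOn ℝ (frenetVector f I (i + 1)) I := by
  have hinit : ∀ i < n - 1, DifferentiableOn ℝ (frenetVector f I (i + 1)) I := by
    intro i hi
    have h0 : ∀ k < n - 1, ∀ t ∈ I,
        gramSchmidt ℝ (fun k : ℕ => iteratedDerivWithin (k + 1) f I t) k ≠ 0 := fun k hk t ht =>
      gramSchmidt_ne_zero_coe _ (h.linearIndependent_Iic ht (by omega))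
    have h1 := differentiableOn_gramSchmidt (g := fun k => iteratedDerivWithin (k + 1) f I)
      (fun k hk t ht => (hasDerivWithinAt_iteratedDerivWithin hI hf (by omega)
        ht).differentiableWithinAt) h0 i hi
    have h2 : frenetVector f I (i + 1) = fun t =>
        ‖gramSchmidt ℝ (fun k : ℕ => iteratedDerivWithin (k + 1) f I t) i‖⁻¹ •
          gramSchmidt ℝ (fun k : ℕ => iteratedDerivWithin (k + 1) f I t) i := by
      funext t
      rw [frenetVector_succ_of_lt (by omega)]
      rfl
    rw [h2]
    exact ((h1.norm ℝ (h0 i hi)).inv fun t ht => norm_ne_zero_iff.2 (h0 i hi t ht)).fun_smul h1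
  by_cases hi' : i < n - 1
  · exact hinit i hi'
  · have hin : i + 1 = n := by omega
    have : frenetVector f I n =
        fun t => crossProd fun i : Fin (n - 1) => frenetVector f I (i + 1) t :=
      funext frenetVector_last
    rw [hin, this]
    exact differentiableOn_crossProd fun k => hinit k k.2

/-- The derivative of the `i`-th vector of the Frenet frame has no component on the `j`-th one for
`j > i + 1`. As the `j`-th vector is orthogonal to `f', …, f⁽ʲ⁻¹⁾`, its derivative is orthogonal to
`f', …, f⁽ʲ⁻²⁾`, hence to the `i`-th vector, and the product rule moves the derivative across. -/
theorem IsRegular.inner_derivWithin_frenetVector_eq_zero (hI : UniqueDiffOn ℝ I)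
    (hf : ContDiffOn ℝ n f I) (h : IsRegular (n - 1) f I) {i j : ℕ} (hij : i + 1 < j) (hj : j < n)
    {t : ℝ} (ht : t ∈ I) :
    ⟪derivWithin (frenetVector f I (i + 1)) I t, frenetVector f I (j + 1) t⟫_ℝ = 0 := by
  have hdj := h.differentiableOn_frenetVector hI hf hj
  have horth : ∀ k < j, ∀ s ∈ I, ⟪frenetVector f I (k + 1) s, frenetVector f I (j + 1) s⟫_ℝ = 0 :=
    fun k hk s hs => (h.orthonormal_frenetVector (by omega) hs).2
      (i := ⟨k, by omega⟩) (j := ⟨j, hj⟩) fun h => by simp only [Fin.mk.injEq] at h; omega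
  have hspan : ∀ (k : ℕ) (s : ℝ),
      Submodule.span ℝ (gramSchmidtNormed ℝ (fun l : ℕ => iteratedDerivWithin (l + 1) f I s) ''
        Set.Iic k) =
      Submodule.span ℝ ((fun l : ℕ => iteratedDerivWithin (l + 1) f I s) '' Set.Iic k) :=
    fun k s => by rw [span_gramSchmidtNormed, span_gramSchmidt_Iic]
  have hperp : ∀ (S : Set (EuclideanSpace ℝ (Fin n))) (y : EuclideanSpace ℝ (Fin n)),
      (∀ x ∈ S, ⟪x, y⟫_ℝ = 0) → ∀ x ∈ Submodule.span ℝ S, ⟪x, y⟫_ℝ = 0 := by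
    intro S y hS x hx
    induction hx using Submodule.span_induction with
    | mem x hx => exact hS x hx
    | zero => exact inner_zero_left _
    | add x z _ _ hx hz => rw [inner_add_left, hx, hz, add_zero]
    | smul c x _ hx => rw [inner_smul_left, hx, mul_zero]
  have hg : ∀ k < j, ∀ s ∈ I,
      ⟪iteratedDerivWithin (k + 1) f I s, frenetVector f I (j + 1) s⟫_ℝ = 0 := by
    intro k hk s hs
    refine hperp _ _ ?_ _ ((hspan k s).ge (Submodule.subset_span ⟨k, Set.self_mem_Iic, rfl⟩))
    rintro _ ⟨l, hl, rfl⟩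
    have hl' : l ≤ k := hl
    rw [← frenetVector_succ_of_lt (by omega)]
    exact horth l (by omega) s hs
  have hg' : ∀ k, k + 1 < j →
      ⟪iteratedDerivWithin (k + 1) f I t, derivWithin (frenetVector f I (j + 1)) I t⟫_ℝ = 0 := by
    intro k hk
    have hd : ∀ s ∈ I, HasDerivWithinAt (iteratedDerivWithin (k + 1) f I)
        (iteratedDerivWithin (k + 1 + 1) f I s) I s := fun s hs =>
      hasDerivWithinAt_iteratedDerivWithin hI hf (by omega) hs
    have h1 := inner_derivWithin_add_eq_zero hI (fun s hs => (hd s hs).differentiableWithinAt) hdj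
      (hg k (by omega)) ht
    rwa [(hd t ht).derivWithin (hI t ht), hg (k + 1) hk t ht, zero_add] at h1
  have hi : ⟪frenetVector f I (i + 1) t, derivWithin (frenetVector f I (j + 1)) I t⟫_ℝ = 0 := by
    rw [frenetVector_succ_of_lt (by omega)]
    refine hperp _ _ ?_ _ ((hspan i t).le (Submodule.subset_span ⟨i, Set.self_mem_Iic, rfl⟩))
    rintro _ ⟨l, hl, rfl⟩
    have hl' : l ≤ i := hl
    exact hg' l (by omega)
  have h1 := inner_derivWithin_add_eq_zero hI
    (h.differentiableOn_frenetVector hI hf (by omega)) hdj (horth i (by omega)) ht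
  rwa [hi, add_zero] at h1

theorem hasDerivWithinAt_eq_speed_smul (hn : 1 < n)
    (hf : ContDiffOn ℝ n f I) {t : ℝ} (ht : t ∈ I) (h0 : speed f I t ≠ 0) :
    HasDerivWithinAt f (speed f I t • frenetVector f I 1 t) I t := by
  have h1 : frenetVector f I 1 t = (speed f I t)⁻¹ • derivWithin f I t := by
    rw [frenetVector_succ_of_lt (i := 0) hn]
    have h : gramSchmidt ℝ (fun k : ℕ => iteratedDerivWithin (k + 1) f I t) 0 =
        derivWithin f I t := by
      rw [← bot_eq_zero, gramSchmidt_bot]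
      simp [iteratedDerivWithin_one]
    simp [gramSchmidtNormed, h, speed]
  rw [h1, smul_inv_smul₀ h0]
  exact (hf.differentiableOn (by exact_mod_cast (by omega : n ≠ 0)) t ht).hasDerivWithinAt

end

end EuclideanCurve

/-! ### Singular values of bidiagonal matrices -/

section

open Matrix

/-- A singular value decomposition of an invertible real matrix: `u` is an eigenbasis of `B Bᵀ`, the
`a j` are the square roots of its eigenvalues, and `v j = Bᵀ (u j) / a j`. -/
theorem Matrix.exists_singular_bases {m : ℕ} (B : Matrix (Fin m) (Fin m) ℝ) (hB : B.det ≠ 0) :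
    ∃ (a : Fin m → ℝ) (u v : OrthonormalBasis (Fin m) ℝ (EuclideanSpace ℝ (Fin m))),
      (∀ j, 0 < a j) ∧ (∀ j k, ∑ l, B k l * v j l = a j * u j k) ∧
        ∀ j l, ∑ k, B k l * u j k = a j * v j l := by
  have hU : IsUnit B := (Matrix.isUnit_iff_isUnit_det B).2 (isUnit_iff_ne_zero.2 hB)
  have hpd : (B * Bᴴ).PosDef := Matrix.PosDef.mul_conjTranspose_self B
    (Matrix.vecMul_injective_of_isUnit hU)
  have hh := hpd.isHermitian
  set u := hh.eigenvectorBasis with hu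
  set μ := hh.eigenvalues with hμ
  have hμpos : ∀ j, 0 < μ j := hpd.eigenvalues_pos
  set a : Fin m → ℝ := fun j => √(μ j) with ha
  have hapos : ∀ j, 0 < a j := fun j => Real.sqrt_pos.2 (hμpos j)
  have haa : ∀ j, a j * a j = μ j := fun j => Real.mul_self_sqrt (hμpos j).le
  let w : Fin m → EuclideanSpace ℝ (Fin m) := fun j =>
    WithLp.toLp 2 ((a j)⁻¹ • (Bᵀ *ᵥ (u j).ofLp))
  have hBB : ∀ j, B *ᵥ (Bᵀ *ᵥ (u j).ofLp) = μ j • (u j).ofLp := fun j => by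
    rw [Matrix.mulVec_mulVec]
    exact hh.mulVec_eigenvectorBasis j
  have hw : Orthonormal ℝ w := by
    rw [orthonormal_iff_ite]
    intro i j
    have h1 : ⟪w i, w j⟫_ℝ = (a i)⁻¹ * (a j)⁻¹ * (μ j * ⟪u i, u j⟫_ℝ) := by
      simp only [w, EuclideanSpace.inner_eq_star_dotProduct, star_trivial, smul_dotProduct,
        dotProduct_smul, smul_eq_mul]
      rw [Matrix.mulVec_transpose B (u i).ofLp, dotProduct_comm, ← Matrix.dotProduct_mulVec, hBB,
        dotProduct_smul, smul_eq_mul, dotProduct_comm]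
      ring
    rw [h1, orthonormal_iff_ite.1 u.orthonormal]
    split_ifs with hij
    · subst hij
      rw [← haa i]
      have := (hapos i).ne'
      field_simp
    · simp
  refine ⟨a, u, OrthonormalBasis.mk hw ?_, hapos, fun j k => ?_, fun j l => ?_⟩
  · exact (hw.linearIndependent.span_eq_top_of_card_eq_finrank' (by simp)).ge
  · have h := congrFun (hBB j) k
    rw [Matrix.mulVec, dotProduct] at h
    simp only [OrthonormalBasis.coe_mk, w, Pi.smul_apply, smul_eq_mul]
    rw [Pi.smul_apply, smul_eq_mul, ← haa] at h
    have h0 := (hapos j).ne'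
    have : ∀ l, B k l * ((a j)⁻¹ * (Bᵀ *ᵥ (u j).ofLp) l) =
        (a j)⁻¹ * (B k l * (Bᵀ *ᵥ (u j).ofLp) l) := fun l => by ring
    simp_rw [this]
    rw [← Finset.mul_sum, h]
    field_simp
  · simp only [OrthonormalBasis.coe_mk, w, Pi.smul_apply, smul_eq_mul, Matrix.mulVec, dotProduct,
      Matrix.transpose_apply]
    rw [mul_inv_cancel_left₀ (hapos j).ne']

end

/-- The lower bidiagonal matrix with diagonal entries `ω 0, ω 2, ω 4, …` and subdiagonal entries
`-ω 1, -ω 3, …`. It is the off-diagonal block of a skew tridiagonal matrix of even size with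
superdiagonal `ω`, after the even indices are listed before the odd ones. -/
def skewBidiagonal (m : ℕ) (ω : ℕ → ℝ) : Matrix (Fin m) (Fin m) ℝ :=
  Matrix.of fun k l =>
    if (l : ℕ) = k then ω (2 * k) else if (l : ℕ) + 1 = k then -ω (2 * l + 1) else 0

theorem det_skewBidiagonal_ne_zero {m : ℕ} {ω : ℕ → ℝ} (hω : ∀ i < 2 * m - 1, ω i ≠ 0) :
    (skewBidiagonal m ω).det ≠ 0 := by
  rw [Matrix.det_of_isLowerTriangular]
  · refine Finset.prod_ne_zero_iff.2 fun k _ => ?_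
    simpa [skewBidiagonal] using hω (2 * k) (by omega)
  · intro k l hkl
    have : (k : ℕ) < l := hkl
    simp only [skewBidiagonal, Matrix.of_apply]
    rw [if_neg (by omega), if_neg (by omega)]

/-- If `u` and `v` are singular vectors of a bidiagonal matrix for the singular value `a` and `u`
has first coordinate zero, then the two systems of two-term recurrences force `u = 0`. -/
theorem eq_zero_of_skewBidiagonal_singular {m : ℕ} {ω : ℕ → ℝ} (hω : ∀ i < 2 * m - 1, ω i ≠ 0)
    {a : ℝ} {u v : Fin m → ℝ}
    (hv : ∀ k, ∑ l, skewBidiagonal m ω k l * v l = a * u k)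
    (hu : ∀ l, ∑ k, skewBidiagonal m ω k l * u k = a * v l)
    (h0 : ∀ k : Fin m, (k : ℕ) = 0 → u k = 0) : u = 0 := by
  have key : ∀ i : ℕ, ∀ hi : i < m, u ⟨i, hi⟩ = 0 ∧ ∀ j : Fin m, (j : ℕ) < i → v j = 0 := by
    intro i
    induction i with
    | zero => exact fun hi => ⟨h0 _ rfl, fun j hj => absurd hj (by omega)⟩
    | succ i ih =>
      intro hi
      obtain ⟨hui, hvi⟩ := ih (by omega)
      have hv1 : v ⟨i, by omega⟩ = 0 := by
        have h := hv ⟨i, by omega⟩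
        rw [hui, mul_zero, Finset.sum_eq_single ⟨i, by omega⟩] at h
        · simp only [skewBidiagonal, Matrix.of_apply, if_true] at h
          exact (mul_eq_zero.1 h).resolve_left (hω _ (by omega))
        · intro l _ hl
          have hl' : (l : ℕ) ≠ i := fun h => hl (Fin.ext h)
          simp only [skewBidiagonal, Matrix.of_apply, if_neg hl']
          split_ifs with h1
          · rw [hvi l (by omega), mul_zero]
          · exact zero_mul _
        · simp
      refine ⟨?_, fun j hj => ?_⟩
      · have h := hu ⟨i, by omega⟩
        rw [hv1, mul_zero, Finset.sum_eq_single ⟨i + 1, hi⟩] at h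
        · simp only [skewBidiagonal, Matrix.of_apply, if_true] at h
          rw [if_neg (by omega)] at h
          exact (mul_eq_zero.1 h).resolve_left (neg_ne_zero.2 (hω _ (by omega)))
        · intro k _ hk
          have hk' : i + 1 ≠ (k : ℕ) := fun h => hk (Fin.ext h.symm)
          simp only [skewBidiagonal, Matrix.of_apply, if_neg hk']
          split_ifs with h1
          · have : k = ⟨i, by omega⟩ := Fin.ext h1.symm
            rw [this, hui, mul_zero]
          · exact zero_mul _
        · simp
      · rcases Nat.lt_succ_iff_lt_or_eq.1 hj with h | h
        · exact hvi j h
        · rw [← hv1]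
          exact congrArg v (Fin.ext h)
  funext k
  exact (key k k.2).1

/-! ### Uniform circular motions -/

theorem Convex.eq_of_hasDerivWithinAt_zero {E : Type*} [NormedAddCommGroup E] [NormedSpace ℝ E]
    {I : Set ℝ} (hI : Convex ℝ I) {g : ℝ → E} (hg : ∀ t ∈ I, HasDerivWithinAt g 0 I t) {s t : ℝ}
    (hs : s ∈ I) (ht : t ∈ I) : g t = g s := by
  have h := hI.norm_image_sub_le_of_norm_hasDerivWithin_le (C := 0) hg (by simp) hs ht
  rw [zero_mul] at h
  exact sub_eq_zero.1 (norm_le_zero_iff.1 h)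

/-- The solutions of `P' = a Q`, `Q' = -a P`, in terms of the values at `s`. -/
theorem eq_cos_smul_sub_sin_smul {E : Type*} [NormedAddCommGroup E] [NormedSpace ℝ E]
    {I : Set ℝ} (hI : Convex ℝ I) {P Q : ℝ → E} {a : ℝ}
    (hP : ∀ t ∈ I, HasDerivWithinAt P (a • Q t) I t)
    (hQ : ∀ t ∈ I, HasDerivWithinAt Q (-(a • P t)) I t) {s t : ℝ} (hs : s ∈ I) (ht : t ∈ I) :
    Q t = Real.cos (a * t) • (Real.sin (a * s) • P s + Real.cos (a * s) • Q s) -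
      Real.sin (a * t) • (Real.cos (a * s) • P s - Real.sin (a * s) • Q s) := by
  have hcos : ∀ t, HasDerivWithinAt (fun t => Real.cos (a * t)) (-Real.sin (a * t) * a) I t :=
    fun t => by simpa using (((hasDerivAt_id t).const_mul a).cos).hasDerivWithinAt
  have hsin : ∀ t, HasDerivWithinAt (fun t => Real.sin (a * t)) (Real.cos (a * t) * a) I t :=
    fun t => by simpa using (((hasDerivAt_id t).const_mul a).sin).hasDerivWithinAt
  have h1 := hI.eq_of_hasDerivWithinAt_zero
    (g := fun t => Real.sin (a * t) • P t + Real.cos (a * t) • Q t) (fun t ht => by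
      refine (((hsin t).fun_smul (hP t ht)).fun_add ((hcos t).fun_smul (hQ t ht))).congr_deriv ?_
      module) hs ht
  have h2 := hI.eq_of_hasDerivWithinAt_zero
    (g := fun t => Real.cos (a * t) • P t - Real.sin (a * t) • Q t) (fun t ht => by
      refine (((hcos t).fun_smul (hP t ht)).fun_sub ((hsin t).fun_smul (hQ t ht))).congr_deriv ?_
      module) hs ht
  beta_reduce at h1 h2
  rw [← h1, ← h2]
  have h3 := Real.sin_sq_add_cos_sq (a * t)
  calc
    Q t = (Real.sin (a * t) ^ 2 + Real.cos (a * t) ^ 2) • Q t := by rw [h3, one_smul]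
    _ = _ := by module

/-- A curve whose velocity is a multiple of `α 0`, for a frame `α, β` that satisfies
`α' = B β` and `β' = -Bᵀ α` with `B` bidiagonal, is a combination of uniform circular motions in
mutually orthogonal planes. -/
theorem exists_circular_motions {m : ℕ} {E : Type*} [NormedAddCommGroup E] [InnerProductSpace ℝ E]
    {I : Set ℝ} (hI : Convex ℝ I) {s : ℝ} (hs : s ∈ I) {ω : ℕ → ℝ}
    (hω : ∀ i < 2 * m - 1, ω i ≠ 0) (hm : 0 < m) {ν : ℝ} (hν : ν ≠ 0) {α β : Fin m → ℝ → E}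
    (hαα : Orthonormal ℝ fun k => α k s) (hββ : Orthonormal ℝ fun k => β k s)
    (hαβ : ∀ k l, ⟪α k s, β l s⟫_ℝ = 0)
    (hα : ∀ k, ∀ t ∈ I, HasDerivWithinAt (α k) (∑ l, skewBidiagonal m ω k l • β l t) I t)
    (hβ : ∀ l, ∀ t ∈ I, HasDerivWithinAt (β l) (-∑ k, skewBidiagonal m ω k l • α k t) I t)
    {f : ℝ → E} (hf : ∀ t ∈ I, HasDerivWithinAt f (ν • α ⟨0, hm⟩ t) I t) :
    ∃ (a r : Fin m → ℝ) (c : E) (x y : Fin m → E), (∀ j, 0 < a j) ∧ (∀ j, 0 < r j) ∧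
      Orthonormal ℝ x ∧ Orthonormal ℝ y ∧ (∀ i j, ⟪x i, y j⟫_ℝ = 0) ∧
      ∀ t ∈ I, f t = c + ∑ j, ((r j * Real.cos (a j * t)) • x j +
        (r j * Real.sin (a j * t)) • y j) := by
  obtain ⟨a, u, v, ha, hv, hu⟩ :=
    (skewBidiagonal m ω).exists_singular_bases (det_skewBidiagonal_ne_zero hω)
  have hu0 : ∀ j, u j ⟨0, hm⟩ ≠ 0 := by
    intro j h
    refine u.orthonormal.ne_zero j ?_
    have := eq_zero_of_skewBidiagonal_singular hω (hv j) (hu j)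
      fun k hk => by rw [← h]; exact congrArg (u j).ofLp (Fin.ext hk)
    ext k
    exact congrFun this k
  let P : Fin m → ℝ → E := fun j t => ∑ k, u j k • α k t
  let Q : Fin m → ℝ → E := fun j t => ∑ l, v j l • β l t
  have hP : ∀ j, ∀ t ∈ I, HasDerivWithinAt (P j) (a j • Q j t) I t := by
    intro j t ht
    refine (HasDerivWithinAt.fun_sum fun k _ =>
      (hα k t ht).fun_const_smul (u j k)).congr_deriv ?_
    simp only [Q, Finset.smul_sum, smul_smul]
    rw [Finset.sum_comm]
    refine Finset.sum_congr rfl fun l _ => ?_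
    rw [← hu, Finset.sum_smul]
    exact Finset.sum_congr rfl fun k _ => by rw [mul_comm]
  have hQ : ∀ j, ∀ t ∈ I, HasDerivWithinAt (Q j) (-(a j • P j t)) I t := by
    intro j t ht
    refine (HasDerivWithinAt.fun_sum fun l _ =>
      (hβ l t ht).fun_const_smul (v j l)).congr_deriv ?_
    simp only [P, Finset.smul_sum, smul_smul, smul_neg, Finset.sum_neg_distrib]
    rw [Finset.sum_comm]
    congr 1
    refine Finset.sum_congr rfl fun k _ => ?_
    rw [← hv, Finset.sum_smul]
    exact Finset.sum_congr rfl fun l _ => by rw [mul_comm]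
  have hα0 : ∀ t, α ⟨0, hm⟩ t = ∑ j, u j ⟨0, hm⟩ • P j t := by
    intro t
    simp only [P, Finset.smul_sum, smul_smul]
    rw [Finset.sum_comm]
    have h : ∀ k, ∑ j, u j ⟨0, hm⟩ * u j k = if ⟨0, hm⟩ = k then 1 else 0 := by
      intro k
      have := u.sum_inner_mul_inner (EuclideanSpace.single ⟨0, hm⟩ (1 : ℝ))
        (EuclideanSpace.single k (1 : ℝ))
      simpa [EuclideanSpace.inner_single_left, EuclideanSpace.inner_single_right,
        Pi.single_apply, eq_comm (a := k)] using this
    simp_rw [← Finset.sum_smul, h]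
    simp
  -- `Q j` is, up to the factor `-a j`, an antiderivative of `P j`.
  let d : Fin m → ℝ := fun j => -(ν * u j ⟨0, hm⟩ / a j)
  have hd : ∀ j, d j ≠ 0 := fun j =>
    neg_ne_zero.2 (div_ne_zero (mul_ne_zero hν (hu0 j)) (ha j).ne')
  have hconst : ∀ t ∈ I, f t - ∑ j, d j • Q j t = f s - ∑ j, d j • Q j s := fun t ht =>
    hI.eq_of_hasDerivWithinAt_zero (g := fun t => f t - ∑ j, d j • Q j t) (fun t ht => by
      refine ((hf t ht).fun_sub (HasDerivWithinAt.fun_sum fun j _ =>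
        (hQ j t ht).fun_const_smul (d j))).congr_deriv ?_
      rw [hα0, Finset.smul_sum, sub_eq_zero]
      refine Finset.sum_congr rfl fun j _ => ?_
      have := (ha j).ne'
      simp only [d, smul_neg, smul_smul]
      rw [neg_mul, div_mul_cancel₀ _ this, neg_smul, neg_neg]) hs ht
  have hPP : ∀ i j, ⟪P i s, P j s⟫_ℝ = if i = j then 1 else 0 := by
    intro i j
    rw [← orthonormal_iff_ite.1 u.orthonormal i j]
    simp only [P, hαα.inner_sum, PiLp.inner_apply]
    exact Finset.sum_congr rfl fun k _ => by simp [mul_comm]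
  have hQQ : ∀ i j, ⟪Q i s, Q j s⟫_ℝ = if i = j then 1 else 0 := by
    intro i j
    rw [← orthonormal_iff_ite.1 v.orthonormal i j]
    simp only [Q, hββ.inner_sum, PiLp.inner_apply]
    exact Finset.sum_congr rfl fun k _ => by simp [mul_comm]
  have hPQ : ∀ i j, ⟪P i s, Q j s⟫_ℝ = 0 := by
    intro i j
    simp [P, Q, sum_inner, inner_sum, inner_smul_left, inner_smul_right, hαβ]
  have hQP : ∀ i j, ⟪Q i s, P j s⟫_ℝ = 0 := fun i j => by rw [real_inner_comm, hPQ]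
  -- The signs of the coefficients are absorbed into the planes.
  let σ : Fin m → ℝ := fun j => d j / |d j|
  have hσ : ∀ j, σ j * σ j = 1 := fun j => by
    have := abs_ne_zero.2 (hd j)
    simp only [σ]
    rw [div_mul_div_comm, abs_mul_abs_self, div_self (mul_ne_zero (hd j) (hd j))]
  have hdσ : ∀ j, |d j| * σ j = d j := fun j => mul_div_cancel₀ _ (abs_ne_zero.2 (hd j))
  refine ⟨a, fun j => |d j|, f s - ∑ j, d j • Q j s,
    fun j => σ j • (Real.sin (a j * s) • P j s + Real.cos (a j * s) • Q j s),
    fun j => -σ j • (Real.cos (a j * s) • P j s - Real.sin (a j * s) • Q j s),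
    ha, fun j => abs_pos.2 (hd j), ?_, ?_, ?_, ?_⟩
  · rw [orthonormal_iff_ite]
    intro i j
    simp only [inner_smul_left, inner_smul_right, inner_add_left, inner_add_right, hPP, hQQ, hPQ,
      hQP, conj_trivial]
    split_ifs with hij
    · subst hij
      linear_combination hσ i + σ i * σ i * Real.sin_sq_add_cos_sq (a i * s)
    · ring
  · rw [orthonormal_iff_ite]
    intro i j
    simp only [inner_smul_left, inner_smul_right, inner_sub_left, inner_sub_right, hPP, hQQ, hPQ,
      hQP, conj_trivial]
    split_ifs with hij
    · subst hij
      linear_combination hσ i + σ i * σ i * Real.sin_sq_add_cos_sq (a i * s)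
    · ring
  · intro i j
    simp only [inner_smul_left, inner_smul_right, inner_add_left, inner_sub_right, hPP, hQQ, hPQ,
      hQP, conj_trivial]
    split_ifs with hij
    · subst hij
      ring
    · ring
  · intro t ht
    rw [← hconst t ht]
    have : ∑ j, d j • Q j t = ∑ j, ((|d j| * Real.cos (a j * t)) •
          σ j • (Real.sin (a j * s) • P j s + Real.cos (a j * s) • Q j s) +
        (|d j| * Real.sin (a j * t)) •
          -σ j • (Real.cos (a j * s) • P j s - Real.sin (a j * s) • Q j s)) := by
      refine Finset.sum_congr rfl fun j _ => ?_
      rw [eq_cos_smul_sub_sin_smul hI (hP j) (hQ j) hs ht]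
      nth_rewrite 1 [← hdσ j]
      module
    rw [← this, sub_add_cancel]

namespace EuclideanCurve

/-- Orthogonal planes spanned by the pairs `x j, y j` can be moved by an isometry to the coordinate
planes of `ℂᵐ`. -/
theorem exists_isometryEquiv_complexRep {n : ℕ} (hn : Even n)
    {x y : Fin (n / 2) → EuclideanSpace ℝ (Fin n)} (hx : Orthonormal ℝ x) (hy : Orthonormal ℝ y)
    (hxy : ∀ i j, ⟪x i, y j⟫_ℝ = 0) (c : EuclideanSpace ℝ (Fin n)) :
    ∃ F : EuclideanSpace ℝ (Fin n) ≃ᵢ EuclideanSpace ℝ (Fin n), ∀ p q : Fin (n / 2) → ℝ,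
      complexRep (F (c + ∑ j, (p j • x j + q j • y j))) =
        WithLp.toLp 2 fun j => (⟨p j, q j⟩ : ℂ) := by
  have h2 : 2 * (n / 2) = n := Nat.two_mul_div_two_of_even hn
  have horth : Orthonormal ℝ (Sum.elim x y) := by
    rw [orthonormal_iff_ite]
    rintro (i | i) (j | j)
    · simpa using orthonormal_iff_ite.1 hx i j
    · simpa using hxy i j
    · simpa [real_inner_comm] using hxy j i
    · simpa using orthonormal_iff_ite.1 hy i j
  let b : OrthonormalBasis (Fin (n / 2) ⊕ Fin (n / 2)) ℝ (EuclideanSpace ℝ (Fin n)) :=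
    OrthonormalBasis.mk horth
      (horth.linearIndependent.span_eq_top_of_card_eq_finrank' (by simp; omega)).ge
  let e : Fin (n / 2) ⊕ Fin (n / 2) ≃ Fin n := Equiv.ofBijective
    (Sum.elim (fun j => ⟨2 * (j : ℕ), by omega⟩) (fun j => ⟨2 * (j : ℕ) + 1, by omega⟩)) (by
      rw [Fintype.bijective_iff_injective_and_card]
      refine ⟨?_, by simp; omega⟩
      rintro (i | i) (j | j) hij <;> simp [Fin.ext_iff] at hij ⊢ <;> omega)
  refine ⟨(IsometryEquiv.subRight c).trans (b.reindex e).repr.toIsometryEquiv, fun p q => ?_⟩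
  have hcoord : ∀ i, (b.reindex e).repr (∑ j, (p j • x j + q j • y j)) (e i) = Sum.elim p q i := by
    intro i
    have : ∑ j, (p j • x j + q j • y j) = ∑ i, Sum.elim p q i • b i := by
      simp [b, Finset.sum_add_distrib]
    rw [this, OrthonormalBasis.repr_apply_apply, OrthonormalBasis.reindex_apply,
      Equiv.symm_apply_apply, b.orthonormal.inner_right_fintype]
  ext j
  simp only [complexRep, IsometryEquiv.trans_apply, IsometryEquiv.subRight_apply,
    add_sub_cancel_left, LinearIsometryEquiv.coe_toIsometryEquiv]
  exact Complex.ext (hcoord (Sum.inl j)) (hcoord (Sum.inr j))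

end EuclideanCurve

theorem mainTheorem4 (n : ℕ) (hn : 2 ≤ n) (hn_even : Even n)
    (ν : ℝ) (hν : 0 < ν)
    (κ : ℕ → ℝ) (hκ_pos : ∀ j, 1 ≤ j → j ≤ n - 2 → 0 < κ j) (hκ_last : κ (n - 1) ≠ 0)
    (I : Set ℝ) (hI : I.OrdConnected) (hI_nontrivial : I.Nontrivial)
    (f : ℝ → EuclideanSpace ℝ (Fin n)) (hf : ContDiffOn ℝ n f I)
    (hf_regular : EuclideanCurve.IsRegular (n - 1) f I)
    (hf_speed : ∀ t ∈ I, EuclideanCurve.speed f I t = ν)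
    (hf_curvature : ∀ j, 1 ≤ j → j ≤ n - 1 → ∀ t ∈ I, EuclideanCurve.curvature f I j t = κ j) :
    ∃ a r : Fin (n / 2) → ℝ, (∀ j, 0 < a j) ∧ (∀ j, 0 < r j) ∧
      ∃ F : EuclideanSpace ℝ (Fin n) ≃ᵢ EuclideanSpace ℝ (Fin n),
        ∀ t ∈ I, EuclideanCurve.complexRep (F (f t)) =
          WithLp.toLp 2 fun j => (r j : ℂ) * Complex.exp (Complex.I * (t : ℂ) * (a j : ℂ)) := by
  open EuclideanCurve in
  have hU := hI.uniqueDiffOn_of_nontrivial hI_nontrivial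
  have hm : 2 * (n / 2) = n := Nat.two_mul_div_two_of_even hn_even
  obtain ⟨s, hs⟩ := hI_nontrivial.nonempty
  -- The frame is indexed from zero: `X i` is the Frenet vector `Vᵢ₊₁`, so `⟪X i', X (i + 1)⟫ = ω i`.
  let ω : ℕ → ℝ := fun i => ν * κ (i + 1)
  have hω : ∀ i < 2 * (n / 2) - 1, ω i ≠ 0 := by
    intro i hi
    refine mul_ne_zero hν.ne' ?_
    by_cases h : i + 1 = n - 1
    · rwa [h]
    · exact (hκ_pos (i + 1) (by omega) (by omega)).ne'
  let X : ℕ → ℝ → EuclideanSpace ℝ (Fin n) := fun i => frenetVector f I (i + 1)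
  let X' : ℕ → ℝ → EuclideanSpace ℝ (Fin n) := fun i => derivWithin (X i) I
  have hXd : ∀ i < n, ∀ t ∈ I, HasDerivWithinAt (X i) (X' i t) I t := fun i hi t ht =>
    (hf_regular.differentiableOn_frenetVector hU hf hi t ht).hasDerivWithinAt
  have hX : ∀ t ∈ I, Orthonormal ℝ fun i : Fin n => X i t := fun t ht =>
    hf_regular.orthonormal_frenetVector (by omega) ht
  have hXX : ∀ i j, i < n → j < n → ∀ t ∈ I, ⟪X i t, X j t⟫_ℝ = if i = j then 1 else 0 := by
    intro i j hi hj t ht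
    simpa using orthonormal_iff_ite.1 (hX t ht) ⟨i, hi⟩ ⟨j, hj⟩
  have hskew : ∀ i j, i < n → j < n → ∀ t ∈ I, ⟪X' j t, X i t⟫_ℝ = -⟪X' i t, X j t⟫_ℝ := by
    intro i j hi hj t ht
    rw [real_inner_comm]
    exact eq_neg_of_add_eq_zero_right (inner_derivWithin_add_eq_zero hU
      (hf_regular.differentiableOn_frenetVector hU hf hi)
      (hf_regular.differentiableOn_frenetVector hU hf hj) (hXX i j hi hj) ht)
  have hsucc : ∀ i, i + 1 < n → ∀ t ∈ I, ⟪X' i t, X (i + 1) t⟫_ℝ = ω i := by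
    intro i hi t ht
    have h := hf_curvature (i + 1) (by omega) (by omega) t ht
    rw [curvature, hf_speed t ht, div_eq_iff hν.ne'] at h
    simp only [X', X, ω]
    rw [h, mul_comm]
  have hfar : ∀ i j, i + 1 < j → j < n → ∀ t ∈ I, ⟪X' i t, X j t⟫_ℝ = 0 :=
    fun i j hij hj t ht => hf_regular.inner_derivWithin_frenetVector_eq_zero hU hf hij hj ht
  -- The derivative matrix of the frame is tridiagonal with zero diagonal: it exchanges the vectors of
  -- even index with those of odd index.
  have heven : ∀ i j, i < n → j < n → i ≠ j + 1 → j ≠ i + 1 → ∀ t ∈ I, ⟪X' i t, X j t⟫_ℝ = 0 := by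
    intro i j hi hj h1 h2 t ht
    rcases lt_trichotomy i j with h | h | h
    · exact hfar i j (by omega) hj t ht
    · subst h
      have := hskew i i hi hi t ht
      linarith
    · rw [hskew j i hj hi t ht, hfar j i (by omega) hi t ht, neg_zero]
  have hodd : ∀ k l : Fin (n / 2), ∀ t ∈ I,
      ⟪X' (2 * k) t, X (2 * l + 1) t⟫_ℝ = skewBidiagonal (n / 2) ω k l := by
    intro k l t ht
    simp only [skewBidiagonal, Matrix.of_apply]
    split_ifs with h1 h2
    · rw [h1]
      exact hsucc _ (by omega) t ht
    · rw [hskew (2 * l + 1) (2 * k) (by omega) (by omega) t ht, ← h2]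
      exact congrArg Neg.neg (hsucc (2 * l + 1) (by omega) t ht)
    · exact heven _ _ (by omega) (by omega) (by omega) (by omega) t ht
  have hext : ∀ t ∈ I, ∀ z w : EuclideanSpace ℝ (Fin n),
      (∀ l : Fin (n / 2), ⟪z, X (2 * l) t⟫_ℝ = ⟪w, X (2 * l) t⟫_ℝ) →
      (∀ l : Fin (n / 2), ⟪z, X (2 * l + 1) t⟫_ℝ = ⟪w, X (2 * l + 1) t⟫_ℝ) → z = w := by
    intro t ht z w h0 h1
    let b := OrthonormalBasis.mk (hX t ht)
      ((hX t ht).linearIndependent.span_eq_top_of_card_eq_finrank' (by simp)).ge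
    refine InnerProductSpace.ext_inner_right_basis b.toBasis fun i => ?_
    simp only [b, OrthonormalBasis.coe_toBasis, OrthonormalBasis.coe_mk]
    rcases Nat.even_or_odd' (i : ℕ) with ⟨k, hk | hk⟩
    · rw [hk]
      exact h0 ⟨k, by omega⟩
    · rw [hk]
      exact h1 ⟨k, by omega⟩
  obtain ⟨a, r, c, x, y, ha, hr, hx, hy, hxy, hfxy⟩ :=
    exists_circular_motions (m := n / 2) hI.convex hs hω (by omega) hν.ne'
      (α := fun k => X (2 * k)) (β := fun k => X (2 * k + 1)) (f := f)
      ((hX s hs).comp (fun k : Fin (n / 2) => ⟨2 * k, by omega⟩) fun i j hij => by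
        simp only [Fin.mk.injEq] at hij
        exact Fin.ext (by omega))
      ((hX s hs).comp (fun k : Fin (n / 2) => ⟨2 * k + 1, by omega⟩) fun i j hij => by
        simp only [Fin.mk.injEq] at hij
        exact Fin.ext (by omega))
      (fun k l => by
        rw [hXX _ _ (by omega) (by omega) s hs, if_neg (by omega)])
      (fun k t ht => by
        refine (hXd (2 * k) (by omega) t ht).congr_deriv (hext t ht _ _ (fun l => ?_) fun l => ?_)
        · rw [heven _ _ (by omega) (by omega) (by omega) (by omega) t ht, sum_inner]
          refine (Finset.sum_eq_zero fun i _ => ?_).symm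
          rw [inner_smul_left, hXX _ _ (by omega) (by omega) t ht, if_neg (by omega), mul_zero]
        · rw [hodd k l t ht, sum_inner, Finset.sum_eq_single l]
          · rw [inner_smul_left, hXX _ _ (by omega) (by omega) t ht, if_pos rfl]
            simp
          · intro i _ hi
            have : (i : ℕ) ≠ l := fun h => hi (Fin.ext h)
            rw [inner_smul_left, hXX _ _ (by omega) (by omega) t ht, if_neg (by omega), mul_zero]
          · simp)
      (fun k t ht => by
        refine (hXd (2 * k + 1) (by omega) t ht).congr_deriv
          (hext t ht _ _ (fun l => ?_) fun l => ?_)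
        · rw [hskew _ _ (by omega) (by omega) t ht, hodd l k t ht, inner_neg_left, sum_inner,
            Finset.sum_eq_single l]
          · rw [inner_smul_left, hXX _ _ (by omega) (by omega) t ht, if_pos rfl]
            simp
          · intro i _ hi
            have : (i : ℕ) ≠ l := fun h => hi (Fin.ext h)
            rw [inner_smul_left, hXX _ _ (by omega) (by omega) t ht, if_neg (by omega), mul_zero]
          · simp
        · rw [heven _ _ (by omega) (by omega) (by omega) (by omega) t ht, inner_neg_left, sum_inner]
          refine (neg_eq_zero.2 (Finset.sum_eq_zero fun i _ => ?_)).symm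
          rw [inner_smul_left, hXX _ _ (by omega) (by omega) t ht, if_neg (by omega), mul_zero])
      (fun t ht => by
        have h := hasDerivWithinAt_eq_speed_smul (by omega) hf ht
          (by rw [hf_speed t ht]; exact hν.ne')
        rwa [hf_speed t ht] at h)
  obtain ⟨F, hF⟩ := exists_isometryEquiv_complexRep hn_even hx hy hxy c
  refine ⟨a, r, ha, hr, F, fun t ht => ?_⟩
  rw [hfxy t ht, hF]
  congr 1
  funext j
  have : Complex.I * (t : ℂ) * (a j : ℂ) = ((a j * t : ℝ) : ℂ) * Complex.I := by
    push_cast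
    ring
  rw [this, Complex.exp_mul_I, ← Complex.ofReal_cos, ← Complex.ofReal_sin]
  apply Complex.ext <;> simp [-Complex.ofReal_cos, -Complex.ofReal_sin, -Complex.ofReal_mul]
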